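/- Let $p,n,m$ be nonnegative integers, let $A\in\mathbb R^{p\times n}$ and $B\in\mathbb R^{p\times m}$ satisfy $\mathrm{rge}\,B\subset\mathrm{rge}\,A$, where $\mathrm{rge}$ denotes the range (column space) of a matrix. Let $\mathbb S^n$ be the space of real symmetric $n\times n$ matrices with the Frobenius inner product $\langle V,W\rangle=\mathrm{tr}(VW)$, and let $\mathbb E=\mathbb R^{n\times m}\times\mathbb S^n$ with the inner product $\langle (X,V),(Y,W)\rangle=\mathrm{tr}(X^TY)+\mathrm{tr}(VW)$. For a subset $S$ of one of these spaces $\mathcal E$, the polar of $S$ is $$S^\circ=\{v\in\mathcal E : \langle v,x\rangle\le 1\ \text{ for all } x\in S\}$$ and the horizon cone of $S$ is $$S^\infty=\{v\in\mathcal E : \text{there are reals } \lambda_k\downarrow 0\ (\lambda_k>0) \text{ and points } x_k\in S \text{ with } \lambda_kx_k\to v\}.$$ Put $$\mathcal K_A=\{V\in\mathbb S^n : u^TVu\ge 0\ \text{ for all } u\in\ker A\},\qquad M(V)=\begin{pmatrix}V&A^T\\A&0\end{pmatrix}\quad(V\in\mathbb S^n),$$ let $\mathcal K_A^\circ\subset\mathbb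 S^n$ be the polar of $\mathcal K_A$ in $\mathbb S^n$, let $M(V)^\dagger$ be the Moore-Penrose pseudoinverse of $M(V)$, and let $$\Omega(A,B)=\{(Y,W)\in\mathbb E : AY=B,\ \tfrac12YY^T+W\in\mathcal K_A^\circ\}.$$ Then $$\Omega(A,B)^\circ=\Big\{(X,V)\in\mathbb E : \mathrm{rge}\tbinom XB\subset\mathrm{rge}\,M(V),\ V\in\mathcal K_A,\ \tfrac12\mathrm{tr}\Big(\tbinom XB^TM(V)^\dagger\tbinom XB\Big)\le 1\Big\},$$ $$\Omega(A,B)^\infty=\{0_{n\times m}\}\times\mathcal K_A^\circ,$$ $$(\Omega(A,B)^\circ)^\infty=\Big\{(X,V)\in\mathbb E : \mathrm{rge}\tbinom XB\subset\mathrm{rge}\,M(V),\ V\in\mathcal K_A,\ \tfrac12\mathrm{tr}\Big(\tbinom XB^TM(V)^\dagger\tbinom XB\Big)\le 0\Big\}.$$ -/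

import Mathlib

open Matrix

namespace GMF

/-- The space of real symmetric `n × n` matrices (with the topology inherited from matrices). -/
def Sym (n : ℕ) : Submodule ℝ (Matrix (Fin n) (Fin n) ℝ) where
  carrier := {V | V.IsSymm}
  add_mem' := fun ha hb => Matrix.IsSymm.add ha hb
  zero_mem' := Matrix.isSymm_zero
  smul_mem' := fun c _ ha => Matrix.IsSymm.smul ha c

/-- The Euclidean space of pairs `(X, V)`, `X` real `n × m` and `V` real symmetric `n × n`. -/
abbrev E (n m : ℕ) : Type := Matrix (Fin n) (Fin m) ℝ × Sym n

/-- The Frobenius inner product on symmetric matrices. -/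
def symInner {n : ℕ} (V W : Sym n) : ℝ :=
  Matrix.trace ((V : Matrix (Fin n) (Fin n) ℝ) * (W : Matrix (Fin n) (Fin n) ℝ))

/-- The Frobenius inner product on `E n m`. -/
def pairInner {n m : ℕ} (P Q : E n m) : ℝ :=
  Matrix.trace (P.1ᵀ * Q.1) + symInner P.2 Q.2

/-- The (one-sided) polar set of `S` with respect to the inner product `ip`. -/
def polar {F : Type*} (ip : F → F → ℝ) (S : Set F) : Set F :=
  {v | ∀ x ∈ S, ip v x ≤ 1}

/-- The horizon cone of `S`: all limits of `t k • x k` with `x k ∈ S` and positive scalars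
`t k` decreasing to `0`. -/
def horizonCone {F : Type*} [TopologicalSpace F] [SMul ℝ F] (S : Set F) : Set F :=
  {v | ∃ (t : ℕ → ℝ) (x : ℕ → F), (∀ k, 0 < t k) ∧ Antitone t ∧
    Filter.Tendsto t Filter.atTop (nhds 0) ∧ (∀ k, x k ∈ S) ∧
    Filter.Tendsto (fun k => t k • x k) Filter.atTop (nhds v)}

/-- The symmetric matrices that are positive semidefinite on the subspace `S`. -/
def coneOn {n : ℕ} (S : Submodule ℝ (Fin n → ℝ)) : Set (Sym n) :=
  {V | ∀ u ∈ S, 0 ≤ u ⬝ᵥ ((V : Matrix (Fin n) (Fin n) ℝ) *ᵥ u)}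

/-- The cone `K_A` of symmetric matrices that are positive semidefinite on `ker A`. -/
def K {p n : ℕ} (A : Matrix (Fin p) (Fin n) ℝ) : Set (Sym n) :=
  coneOn (LinearMap.ker A.mulVecLin)

/-- The polar cone of `K_A` in the space of symmetric matrices. -/
def Kpolar {p n : ℕ} (A : Matrix (Fin p) (Fin n) ℝ) : Set (Sym n) :=
  polar symInner (K A)

/-- The symmetric matrix `(1/2) Y Yᵀ`. -/
noncomputable def halfGram {n m : ℕ} (Y : Matrix (Fin n) (Fin m) ℝ) : Sym n :=
  ⟨(1 / 2 : ℝ) • (Y * Yᵀ), (Sym n).smul_mem _ (by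
    show (Y * Yᵀ)ᵀ = Y * Yᵀ
    rw [Matrix.transpose_mul, Matrix.transpose_transpose])⟩

/-- The set `Ω(A, B)`. -/
def Omega {p n m : ℕ} (A : Matrix (Fin p) (Fin n) ℝ) (B : Matrix (Fin p) (Fin m) ℝ) :
    Set (E n m) :=
  {P | A * P.1 = B ∧ halfGram P.1 + P.2 ∈ Kpolar A}

/-- The bordered matrix `M(V) = [[V, Aᵀ], [A, 0]]`. -/
def M {p n : ℕ} (A : Matrix (Fin p) (Fin n) ℝ) (V : Sym n) :
    Matrix (Fin n ⊕ Fin p) (Fin n ⊕ Fin p) ℝ :=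
  Matrix.fromBlocks (V : Matrix (Fin n) (Fin n) ℝ) Aᵀ A 0

/-- The four Penrose conditions: `N` is the Moore-Penrose pseudoinverse of the real matrix `T`. -/
structure IsPinv {ι κ : Type*} [Fintype ι] [Fintype κ] (T : Matrix ι κ ℝ)
    (N : Matrix κ ι ℝ) : Prop where
  mul_mul_self : T * N * T = T
  self_mul_mul : N * T * N = N
  symm_left : (T * N)ᵀ = T * N
  symm_right : (N * T)ᵀ = N * T

/-- The Penrose conditions determine the pseudoinverse. -/
theorem IsPinv.unique {ι κ : Type*} [Fintype ι] [Fintype κ] {T : Matrix ι κ ℝ}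
    {N N' : Matrix κ ι ℝ} (h : IsPinv T N) (h' : IsPinv T N') : N = N' := by
  have e1 : T * N = T * N' := by
    calc T * N = (T * N)ᵀ := h.symm_left.symm
      _ = ((T * N') * (T * N))ᵀ := by rw [← Matrix.mul_assoc, h'.mul_mul_self]
      _ = (T * N) * (T * N') := by rw [Matrix.transpose_mul, h.symm_left, h'.symm_left]
      _ = T * N' := by rw [← Matrix.mul_assoc, h.mul_mul_self]
  have e2 : N * T = N' * T := by
    calc N * T = (N * T)ᵀ := h.symm_right.symm
      _ = ((N * T) * (N' * T))ᵀ := by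
          rw [Matrix.mul_assoc N T (N' * T), ← Matrix.mul_assoc T N' T, h'.mul_mul_self]
      _ = (N' * T) * (N * T) := by rw [Matrix.transpose_mul, h.symm_right, h'.symm_right]
      _ = N' * T := by
          rw [Matrix.mul_assoc N' T (N * T), ← Matrix.mul_assoc T N T, h.mul_mul_self]
  calc N = N * T * N := h.self_mul_mul.symm
    _ = N' * T * N' := by rw [e2, Matrix.mul_assoc, e1, ← Matrix.mul_assoc]
    _ = N' := h'.self_mul_mul

/-- Every real symmetric matrix has a Moore-Penrose pseudoinverse. -/
theorem exists_isPinv_of_isHermitian {κ : Type*} [Fintype κ] [DecidableEq κ]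
    {T : Matrix κ κ ℝ} (hT : T.IsHermitian) : ∃ N, IsPinv T N := by
  set U : Matrix κ κ ℝ := (hT.eigenvectorUnitary : Matrix κ κ ℝ) with hU
  have hUU : Uᵀ * U = 1 := by
    have := Unitary.coe_star_mul_self hT.eigenvectorUnitary
    simpa [hU, Matrix.star_eq_conjTranspose] using this
  have hUc : ∀ Z : Matrix κ κ ℝ, Uᵀ * (U * Z) = Z := fun Z => by
    rw [← Matrix.mul_assoc, hUU, Matrix.one_mul]
  set d := hT.eigenvalues
  have hs : T = U * (diagonal d * Uᵀ) := by
    have := hT.spectral_theorem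
    rw [Unitary.conjStarAlgAut_apply] at this
    rw [← Matrix.mul_assoc]
    simpa [hU, Matrix.star_eq_conjTranspose, Function.comp_def] using this
  refine ⟨U * (diagonal (fun i => (d i)⁻¹) * Uᵀ), ?_, ?_, ?_, ?_⟩
  · rw [hs]
    simp only [Matrix.mul_assoc, hUc]
    simp only [← Matrix.mul_assoc (diagonal _) (diagonal _), diagonal_mul_diagonal]
    congr; ext i
    by_cases h : d i = 0 <;> simp [h]
  · rw [hs]
    simp only [Matrix.mul_assoc, hUc]
    simp only [← Matrix.mul_assoc (diagonal _) (diagonal _), diagonal_mul_diagonal]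
    congr; ext i
    by_cases h : d i = 0 <;> simp [h]
  · rw [hs]
    simp only [Matrix.mul_assoc, hUc]
    simp only [← Matrix.mul_assoc (diagonal _) (diagonal _), diagonal_mul_diagonal]
    simp [Matrix.transpose_mul, Matrix.mul_assoc]
  · rw [hs]
    simp only [Matrix.mul_assoc, hUc]
    simp only [← Matrix.mul_assoc (diagonal _) (diagonal _), diagonal_mul_diagonal]
    simp [Matrix.transpose_mul, Matrix.mul_assoc]

/-- Every real matrix has a Moore-Penrose pseudoinverse. -/
theorem exists_isPinv {ι κ : Type*} [Fintype ι] [Fintype κ] (T : Matrix ι κ ℝ) :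
    ∃ N, IsPinv T N := by
  classical
  have hH : (Tᵀ * T).IsHermitian := by
    simpa using Matrix.isHermitian_conjTranspose_mul_self T
  obtain ⟨N, h1, h2, h3, h4⟩ := exists_isPinv_of_isHermitian hH
  have hNt : IsPinv (Tᵀ * T) Nᵀ := by
    have hS : (Tᵀ * T)ᵀ = Tᵀ * T := by simp [Matrix.transpose_mul]
    clear hH
    generalize Tᵀ * T = S at *
    refine ⟨?_, ?_, ?_, ?_⟩
    · have h := congrArg transpose h1
      rwa [Matrix.transpose_mul, Matrix.transpose_mul, hS, ← Matrix.mul_assoc] at h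
    · have h := congrArg transpose h2
      rwa [Matrix.transpose_mul, Matrix.transpose_mul, hS, ← Matrix.mul_assoc] at h
    · rw [Matrix.transpose_mul, hS] at h4
      rw [h4, Matrix.transpose_mul, hS, h4]
    · rw [Matrix.transpose_mul, hS] at h3
      rw [h3, Matrix.transpose_mul, hS, h3]
  have hNN : Nᵀ = N := hNt.unique ⟨h1, h2, h3, h4⟩
  have key : T * (N * (Tᵀ * T)) = T := by
    have h0 : Tᴴ * T * (N * (Tᵀ * T) - 1) = 0 := by
      rw [Matrix.mul_sub, Matrix.mul_one, Matrix.conjTranspose_eq_transpose_of_trivial,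
        ← Matrix.mul_assoc, h1, sub_self]
    have h5 := (Matrix.conjTranspose_mul_self_mul_eq_zero T _).1 h0
    rwa [Matrix.mul_sub, Matrix.mul_one, sub_eq_zero] at h5
  refine ⟨N * Tᵀ, ?_, ?_, ?_, ?_⟩
  · simpa only [Matrix.mul_assoc] using key
  · calc N * Tᵀ * T * (N * Tᵀ) = (N * (Tᵀ * T) * N) * Tᵀ := by simp only [Matrix.mul_assoc]
      _ = N * Tᵀ := by rw [h2]
  · simp [Matrix.transpose_mul, hNN, Matrix.mul_assoc]
  · simpa only [Matrix.mul_assoc] using h4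

/-- The Moore-Penrose pseudoinverse of a real matrix. -/
noncomputable def pinv {ι κ : Type*} [Fintype ι] [Fintype κ] (T : Matrix ι κ ℝ) :
    Matrix κ ι ℝ :=
  Classical.choose (exists_isPinv T)

theorem isPinv_pinv {ι κ : Type*} [Fintype ι] [Fintype κ] (T : Matrix ι κ ℝ) :
    IsPinv T (pinv T) :=
  Classical.choose_spec (exists_isPinv T)

/-- The range (column space) of a real matrix. -/
def rge {ι κ : Type*} [Fintype κ] (T : Matrix ι κ ℝ) : Submodule ℝ (ι → ℝ) :=
  LinearMap.range T.mulVecLin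

/-- The stacked matrix with upper block `X` and lower block `B`. -/
def stack {p n m : ℕ} (X : Matrix (Fin n) (Fin m) ℝ) (B : Matrix (Fin p) (Fin m) ℝ) :
    Matrix (Fin n ⊕ Fin p) (Fin m) ℝ :=
  Matrix.fromRows X B

end GMF

namespace GMF

variable {p n m : ℕ} {A : Matrix (Fin p) (Fin n) ℝ} {B : Matrix (Fin p) (Fin m) ℝ}

/-! All three formulas rest on the support function of Ω(A,B). Writing W = -½YYᵀ + W' with W' ∈
K_A°, the pairing with (X,V) becomes q(Y) + ⟨V,W'⟩, where q(Y) = tr(XᵀY) - ½tr(YᵀVY) and AY = B.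
Boundedness in W' forces V ∈ K_A, so q is concave on {AY = B}. Its maximizers solve the KKT system
M(V)(Y;L) = (X;B), and the maximal value is the pseudoinverse form (`half_trace_pinv_eq`).
Boundedness of q forces solvability: q is affine along the residual direction, with slope the
squared norm of the residual.

Hence `forall_pairInner_le_iff` describes every sublevel set of the support function. Level 1 is the
polar; level 0 is its horizon cone (`horizonCone_polar_pairInner`). The horizon cone of Ω itself is
computed directly in `horizonCone_Omega`. -/

/-! ### The cone K_A and its polar -/

theorem mem_K_iff {V : Sym n} :
    V ∈ K A ↔ ∀ u, A *ᵥ u = 0 → 0 ≤ u ⬝ᵥ ((V : Matrix (Fin n) (Fin n) ℝ) *ᵥ u) := Iff.rfl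

theorem Sym.transpose_coe (V : Sym n) : (V : Matrix (Fin n) (Fin n) ℝ)ᵀ = V := V.2

theorem symInner_comm (V W : Sym n) : symInner V W = symInner W V :=
  Matrix.trace_mul_comm _ _

theorem symInner_add_right (V W W' : Sym n) :
    symInner V (W + W') = symInner V W + symInner V W' := by
  simp [symInner, Matrix.mul_add]

theorem symInner_smul_right (V W : Sym n) (c : ℝ) : symInner V (c • W) = c * symInner V W := by
  simp [symInner]

theorem symInner_neg_right (V W : Sym n) : symInner V (-W) = -symInner V W := by
  simp [symInner]

theorem smul_mem_K {V : Sym n} (hV : V ∈ K A) {c : ℝ} (hc : 0 ≤ c) : c • V ∈ K A := by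
  rw [mem_K_iff] at *
  intro u hu
  have := mul_nonneg hc (hV u hu)
  simpa [Matrix.smul_mulVec] using this

/-- As `K A` is a cone, its polar is given by nonpositivity. -/
theorem mem_Kpolar_iff {W : Sym n} : W ∈ Kpolar A ↔ ∀ V ∈ K A, symInner V W ≤ 0 := by
  constructor
  · intro h V hV
    by_contra! hpos
    -- The scaling makes the inner product equal to 2, above the polar bound 1.
    have := h _ (smul_mem_K hV (c := 2 / symInner V W) (by positivity))
    rw [symInner_smul_right, symInner_comm W V, div_mul_cancel₀ _ hpos.ne'] at this
    norm_num at this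
  · intro h V hV
    rw [symInner_comm]
    exact (h V hV).trans zero_le_one

theorem smul_mem_Kpolar {W : Sym n} (hW : W ∈ Kpolar A) {c : ℝ} (hc : 0 ≤ c) :
    c • W ∈ Kpolar A := by
  rw [mem_Kpolar_iff] at *
  intro V hV
  rw [symInner_smul_right]
  exact mul_nonpos_of_nonneg_of_nonpos hc (hW V hV)

/-! ### Quadratic forms and points of Ω(A,B) -/

theorem symInner_halfGram (V : Sym n) (Y : Matrix (Fin n) (Fin m) ℝ) :
    symInner V (halfGram Y) = (1 / 2 : ℝ) * trace (Yᵀ * (V.1 * Y)) := by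
  simp only [symInner, halfGram, Matrix.mul_smul, trace_smul, smul_eq_mul]
  rw [trace_mul_comm Yᵀ, Matrix.mul_assoc]

theorem trace_quadratic_nonneg {V : Sym n} (hV : V ∈ K A) {Z : Matrix (Fin n) (Fin m) ℝ}
    (hZ : A * Z = 0) : 0 ≤ trace (Zᵀ * (V.1 * Z)) := by
  refine Finset.sum_nonneg fun j _ => ?_
  refine mem_K_iff.1 hV (Z.col j) ?_
  ext i
  exact congrFun (congrFun hZ i) j

/-- Symmetry of the bilinear form attached to a symmetric matrix. -/
theorem trace_bilinear_comm (V : Sym n) (Y Z : Matrix (Fin n) (Fin m) ℝ) :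
    trace (Zᵀ * (V.1 * Y)) = trace (Yᵀ * (V.1 * Z)) := by
  rw [← trace_transpose]
  simp only [transpose_mul, transpose_transpose, Sym.transpose_coe, Matrix.mul_assoc]

theorem trace_quadratic_add (V : Sym n) (Y Z : Matrix (Fin n) (Fin m) ℝ) :
    trace ((Y + Z)ᵀ * (V.1 * (Y + Z))) =
      trace (Yᵀ * (V.1 * Y)) + 2 * trace (Yᵀ * (V.1 * Z)) + trace (Zᵀ * (V.1 * Z)) := by
  simp only [transpose_add, Matrix.add_mul, Matrix.mul_add, trace_add]
  rw [trace_bilinear_comm V Y Z]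
  ring

theorem mem_Omega_of_mem_Kpolar {Y : Matrix (Fin n) (Fin m) ℝ} (hY : A * Y = B) {W : Sym n}
    (hW : W ∈ Kpolar A) : (Y, -halfGram Y + W) ∈ Omega A B :=
  ⟨hY, by simpa using hW⟩

theorem pairInner_neg_halfGram_add (X Y : Matrix (Fin n) (Fin m) ℝ) (V W : Sym n) :
    pairInner (X, V) (Y, -halfGram Y + W) =
      trace (Xᵀ * Y) - (1 / 2 : ℝ) * trace (Yᵀ * (V.1 * Y)) + symInner V W := by
  simp only [pairInner, symInner_add_right, symInner_neg_right, symInner_halfGram]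
  ring

theorem zero_mem_Kpolar : (0 : Sym n) ∈ Kpolar A :=
  mem_Kpolar_iff.2 fun V _ => by simp [symInner]

/-- The symmetric rank one matrix `- u uᵀ`. -/
def negVecSq (u : Fin n → ℝ) : Sym n :=
  ⟨-vecMulVec u u, (Sym n).neg_mem (by
    show (vecMulVec u u)ᵀ = vecMulVec u u
    exact transpose_vecMulVec u u)⟩

theorem symInner_negVecSq (V : Sym n) (u : Fin n → ℝ) :
    symInner V (negVecSq u) = -(u ⬝ᵥ ((V : Matrix (Fin n) (Fin n) ℝ) *ᵥ u)) := by
  simp only [symInner, negVecSq, Matrix.mul_neg, trace_neg, Matrix.mul_vecMulVec,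
    trace_vecMulVec]
  rw [dotProduct_comm]

/-- The rays through -uuᵀ with u ∈ ker A suffice to detect K_A, so no bipolar theorem is needed. -/
theorem negVecSq_mem_Kpolar {u : Fin n → ℝ} (hu : A *ᵥ u = 0) : negVecSq u ∈ Kpolar A :=
  mem_Kpolar_iff.2 fun V hV => by
    rw [symInner_negVecSq]
    exact neg_nonpos.2 (mem_K_iff.1 hV u hu)

theorem eq_zero_of_forall_add_mul_le {a b c : ℝ} (h : ∀ s : ℝ, a + s * b ≤ c) : b = 0 := by
  by_contra hb
  have := h ((c - a + 1) / b)
  rw [div_mul_cancel₀ _ hb] at this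
  linarith

/-! ### The bordered system and the support function of Ω(A,B) -/

theorem rge_le_iff_exists_mul {ι κ μ : Type*} [Fintype ι] [Fintype κ] [Fintype μ]
    {S : Matrix ι μ ℝ} {T : Matrix ι κ ℝ} : rge S ≤ rge T ↔ ∃ Z : Matrix κ μ ℝ, T * Z = S := by
  classical
  constructor
  · intro h
    have hcol : ∀ j, ∃ z, T *ᵥ z = S.col j := fun j =>
      h ⟨Pi.single j 1, by simp⟩
    choose z hz using hcol
    refine ⟨Matrix.of fun i j => z j i, ?_⟩
    ext i j
    exact congrFun (hz j) i
  · rintro ⟨Z, rfl⟩ _ ⟨u, rfl⟩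
    exact ⟨Z *ᵥ u, by simp [Matrix.mulVec_mulVec]⟩

theorem M_transpose (V : Sym n) : (M A V)ᵀ = M A V := by
  simp [M, fromBlocks_transpose, Sym.transpose_coe]

theorem M_mul_stack (V : Sym n) (Y : Matrix (Fin n) (Fin m) ℝ) (L : Matrix (Fin p) (Fin m) ℝ) :
    M A V * stack Y L = stack (V.1 * Y + Aᵀ * L) (A * Y) := by
  simp [M, stack, fromBlocks_mul_fromRows]

theorem trace_stack (X Y : Matrix (Fin n) (Fin m) ℝ) (B L : Matrix (Fin p) (Fin m) ℝ) :
    trace ((stack X B)ᵀ * stack Y L) = trace (Xᵀ * Y) + trace (Bᵀ * L) := by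
  simp [stack, transpose_fromRows, fromCols_mul_fromRows]

theorem exists_eq_stack (Z : Matrix (Fin n ⊕ Fin p) (Fin m) ℝ) : ∃ Y L, Z = stack Y L :=
  ⟨Z.toRows₁, Z.toRows₂, (fromRows_toRows Z).symm⟩

/-- A solution of the bordered system evaluates the pseudoinverse quadratic form. -/
theorem half_trace_pinv_eq {X Y : Matrix (Fin n) (Fin m) ℝ} {V : Sym n}
    {L : Matrix (Fin p) (Fin m) ℝ} (hY : A * Y = B) (hX : V.1 * Y + Aᵀ * L = X) :
    (1 / 2 : ℝ) * trace ((stack X B)ᵀ * pinv (M A V) * stack X B) =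
      trace (Xᵀ * Y) - (1 / 2 : ℝ) * trace (Yᵀ * (V.1 * Y)) := by
  have hS : M A V * stack Y L = stack X B := by rw [M_mul_stack, hX, hY]
  have h1 : (stack X B)ᵀ * pinv (M A V) * stack X B = (stack Y L)ᵀ * stack X B := by
    rw [← hS, transpose_mul, M_transpose]
    calc _ = (stack Y L)ᵀ * (M A V * pinv (M A V) * M A V * stack Y L) := by
          simp only [Matrix.mul_assoc]
      _ = _ := by rw [(isPinv_pinv (M A V)).mul_mul_self]
  -- Move A across the pairing: ⟨L, AY⟩ = ⟨AᵀL, Y⟩ and AᵀL = X - VY.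
  have h2 : trace (Lᵀ * B) = trace (Yᵀ * X) - trace (Yᵀ * (V.1 * Y)) := by
    rw [← hX, Matrix.mul_add, trace_add, ← hY, ← trace_transpose (Lᵀ * (A * Y))]
    simp [transpose_mul, Matrix.mul_assoc]
  have h3 : trace (Yᵀ * X) = trace (Xᵀ * Y) := by
    rw [← trace_transpose]; simp [transpose_mul]
  rw [h1, trace_stack, h2, h3]
  ring

/-- Sublevel sets of the support function of `Omega A B`. -/
theorem forall_pairInner_le_iff (hAB : rge B ≤ rge A) (P : E n m) (c : ℝ) :
    (∀ Q ∈ Omega A B, pairInner P Q ≤ c) ↔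
      rge (stack P.1 B) ≤ rge (M A P.2) ∧ P.2 ∈ K A ∧
        (1 / 2 : ℝ) * trace ((stack P.1 B)ᵀ * pinv (M A P.2) * stack P.1 B) ≤ c := by
  obtain ⟨X, V⟩ := P
  obtain ⟨Y₀, hY₀⟩ := rge_le_iff_exists_mul.1 hAB
  dsimp only
  constructor
  · intro h
    have hq : ∀ Y : Matrix (Fin n) (Fin m) ℝ, A * Y = B → trace (Xᵀ * Y) - (1 / 2 : ℝ) * trace (Yᵀ * (V.1 * Y)) ≤ c := by
      intro Y hY
      have := h _ (mem_Omega_of_mem_Kpolar hY zero_mem_Kpolar)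
      rw [pairInner_neg_halfGram_add] at this
      simpa [symInner] using this
    have hK : V ∈ K A := by
      rw [mem_K_iff]
      intro u hu
      by_contra! hneg
      set q := u ⬝ᵥ ((V : Matrix (Fin n) (Fin n) ℝ) *ᵥ u) with hqdef
      set a := trace (Xᵀ * Y₀) - (1 / 2 : ℝ) * trace (Y₀ᵀ * (V.1 * Y₀)) with ha
      have hac : a ≤ c := hq _ hY₀
      -- This multiple of -uuᵀ raises the pairing from a to c + 1.
      have hs : 0 ≤ (c - a + 1) / (-q) := div_nonneg (by linarith) (by linarith)
      have := h _ (mem_Omega_of_mem_Kpolar hY₀ (smul_mem_Kpolar (negVecSq_mem_Kpolar hu) hs))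
      rw [pairInner_neg_halfGram_add, symInner_smul_right, symInner_negVecSq, ← ha, ← hqdef,
        div_mul_cancel₀ _ (by linarith)] at this
      linarith
    have hR : ∃ Z : Matrix (Fin n ⊕ Fin p) (Fin m) ℝ, M A V * Z = stack X B := by
      obtain ⟨h1, -, h3, -⟩ := isPinv_pinv (M A V)
      set N := pinv (M A V)
      set S := stack X B with hSdef
      -- Transposing MNM = M, with M and MN symmetric, shows that the residual S - MNS lies in ker
      -- M.
      have hMMN : M A V * (M A V * N) = M A V := by
        have := congrArg transpose h1
        rwa [transpose_mul, h3, M_transpose] at this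
      have hMQ : M A V * (S - M A V * N * S) = 0 := by
        rw [Matrix.mul_sub, ← Matrix.mul_assoc, hMMN, sub_self]
      obtain ⟨U, L, hUL⟩ := exists_eq_stack (S - M A V * N * S)
      -- For a residual (U;L) in ker M, AU = 0 and VU = -AᵀL, so q(Y₀ + sU) is affine in s with
      -- slope ⟨S, (U;L)⟩; being bounded above, it has slope zero.
      have hslope : trace (Sᵀ * (S - M A V * N * S)) = 0 := by
        rw [hUL, M_mul_stack] at hMQ
        have hz : (0 : Matrix (Fin n ⊕ Fin p) (Fin m) ℝ) = stack 0 0 := by simp [stack]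
        rw [hz, stack, stack, fromRows_ext_iff] at hMQ
        obtain ⟨hVU, hAU⟩ := hMQ
        have hVU' : (V : Matrix (Fin n) (Fin n) ℝ) * U = -(Aᵀ * L) := eq_neg_of_add_eq_zero_left hVU
        have hUU : trace (Uᵀ * (V.1 * U)) = 0 := by
          rw [hVU', Matrix.mul_neg, ← Matrix.mul_assoc, ← transpose_mul, hAU]
          simp
        have hYU : trace (Y₀ᵀ * (V.1 * U)) = -trace (Bᵀ * L) := by
          rw [hVU', Matrix.mul_neg, ← Matrix.mul_assoc, ← transpose_mul, hY₀, trace_neg]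
        rw [hUL, hSdef, trace_stack]
        refine eq_zero_of_forall_add_mul_le (c := c)
          (a := trace (Xᵀ * Y₀) - (1 / 2 : ℝ) * trace (Y₀ᵀ * (V.1 * Y₀))) fun s => ?_
        have := hq (Y₀ + s • U) (by simp [Matrix.mul_add, hY₀, hAU])
        rw [trace_quadratic_add] at this
        simp only [Matrix.mul_add, transpose_smul, Matrix.mul_smul, Matrix.smul_mul, trace_add,
          trace_smul, smul_eq_mul, hUU, hYU] at this
        linarith
      have hproj : M A V * N * (S - M A V * N * S) = 0 := by
        rw [Matrix.mul_sub, ← Matrix.mul_assoc (M A V * N), ← Matrix.mul_assoc (M A V * N), h1,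
          sub_self]
      -- The residual is orthogonal both to S and to MNS, hence to itself.
      have hQ : S - M A V * N * S = 0 := by
        rw [← trace_conjTranspose_mul_self_eq_zero_iff, conjTranspose_eq_transpose_of_trivial,
          transpose_sub, transpose_mul, h3, Matrix.sub_mul, trace_sub, hslope, Matrix.mul_assoc,
          hproj]
        simp
      exact ⟨N * S, by rw [← Matrix.mul_assoc]; exact (sub_eq_zero.1 hQ).symm⟩
    refine ⟨rge_le_iff_exists_mul.2 hR, hK, ?_⟩
    obtain ⟨Z, hZ⟩ := hR
    obtain ⟨Y, L, rfl⟩ := exists_eq_stack Z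
    rw [M_mul_stack, stack, stack, fromRows_ext_iff] at hZ
    rw [half_trace_pinv_eq hZ.2 hZ.1]
    exact hq Y hZ.2
  · rintro ⟨hR, hK, hc⟩ ⟨Y, W⟩ ⟨hY, hW⟩
    obtain ⟨Z, hZ⟩ := rge_le_iff_exists_mul.1 hR
    obtain ⟨Y₁, L, rfl⟩ := exists_eq_stack Z
    rw [M_mul_stack, stack, stack, fromRows_ext_iff] at hZ
    obtain ⟨hX, hY₁⟩ := hZ
    rw [half_trace_pinv_eq hY₁ hX] at hc
    dsimp only at hY hW
    have hVW := mem_Kpolar_iff.1 hW V hK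
    rw [symInner_add_right, symInner_halfGram] at hVW
    obtain ⟨U, rfl⟩ : ∃ U, Y = Y₁ + U := ⟨Y - Y₁, by abel⟩
    have hAU : A * U = 0 := by
      rw [Matrix.mul_add, hY₁] at hY
      simpa using hY
    have hU := trace_quadratic_nonneg hK hAU
    have hXU : trace (Xᵀ * U) = trace (Y₁ᵀ * (V.1 * U)) := by
      rw [← hX, transpose_add, transpose_mul, transpose_mul, transpose_transpose,
        Sym.transpose_coe, Matrix.add_mul, Matrix.mul_assoc Lᵀ, hAU]
      simp [Matrix.mul_assoc]
    rw [trace_quadratic_add] at hVW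
    rw [pairInner, Matrix.mul_add, trace_add, hXU]
    linarith

/-! ### Horizon cones -/

theorem pairInner_smul_left (c : ℝ) (P Q : E n m) :
    pairInner (c • P) Q = c * pairInner P Q := by
  simp [pairInner, symInner]
  ring

theorem continuous_pairInner_left (Q : E n m) : Continuous fun P : E n m => pairInner P Q := by
  unfold pairInner symInner
  fun_prop

theorem continuous_symInner_right (V : Sym n) : Continuous fun W : Sym n => symInner V W := by
  unfold symInner
  fun_prop

/-- Scaling ⟨xₖ,Q⟩ ≤ 1 by tₖ → 0 turns the bound into 0; conversely, if P pairs nonpositively with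
S, its whole ray stays in the polar. -/
theorem horizonCone_polar_pairInner (S : Set (E n m)) :
    horizonCone (polar pairInner S) = {P | ∀ Q ∈ S, pairInner P Q ≤ 0} := by
  ext P
  constructor
  · rintro ⟨t, x, ht, -, ht0, hx, hlim⟩ Q hQ
    refine le_of_tendsto_of_tendsto' (((continuous_pairInner_left Q).tendsto P).comp hlim) ht0
      fun k => ?_
    simp only [Function.comp_apply, pairInner_smul_left]
    exact mul_le_of_le_one_right (ht k).le (hx k Q hQ)
  · intro h
    refine ⟨fun k => 1 / ((k : ℝ) + 1), fun k => ((k : ℝ) + 1) • P, fun k => by positivity,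
      fun a b hab => ?_, tendsto_one_div_add_atTop_nhds_zero_nat, fun k Q hQ => ?_, ?_⟩
    · have : (a : ℝ) ≤ b := by exact_mod_cast hab
      dsimp only
      gcongr
    · rw [pairInner_smul_left]
      exact (mul_nonpos_of_nonneg_of_nonpos (by positivity) (h Q hQ)).trans zero_le_one
    · refine tendsto_const_nhds.congr fun k => ?_
      rw [smul_smul, one_div_mul_cancel (by positivity), one_smul]

/-- The identity matrix as an element of `Sym n`. -/
def symOne (n : ℕ) : Sym n := ⟨1, Matrix.isSymm_one⟩

theorem symOne_mem_K : symOne n ∈ K A :=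
  mem_K_iff.2 fun u _ => by
    simpa [symOne] using dotProduct_self_star_nonneg u

/-- Along `Y₀ + ker A`, the form of `V ∈ K A` is bounded below by an affine function. -/
theorem trace_quadratic_ge {V : Sym n} (hV : V ∈ K A) {Y Y₀ : Matrix (Fin n) (Fin m) ℝ}
    (h : A * Y = A * Y₀) :
    2 * trace (Y₀ᵀ * (V.1 * Y)) - trace (Y₀ᵀ * (V.1 * Y₀)) ≤ trace (Yᵀ * (V.1 * Y)) := by
  have h1 := trace_quadratic_nonneg hV (Z := Y - Y₀) (by rw [Matrix.mul_sub, h, sub_self])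
  have h2 := trace_quadratic_add V Y₀ (Y - Y₀)
  rw [add_sub_cancel] at h2
  have h3 : trace (Y₀ᵀ * (V.1 * (Y - Y₀))) =
      trace (Y₀ᵀ * (V.1 * Y)) - trace (Y₀ᵀ * (V.1 * Y₀)) := by
    rw [Matrix.mul_sub, Matrix.mul_sub, trace_sub]
  linarith

theorem horizonCone_Omega (hAB : rge B ≤ rge A) :
    horizonCone (Omega A B) = ({0} : Set (Matrix (Fin n) (Fin m) ℝ)) ×ˢ Kpolar A := by
  obtain ⟨Y₀, hY₀⟩ := rge_le_iff_exists_mul.1 hAB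
  ext ⟨Y, W⟩
  constructor
  · rintro ⟨t, x, ht, -, ht0, hx, hlim⟩
    have hY : Filter.Tendsto (fun k => t k • (x k).1) Filter.atTop (nhds Y) :=
      (continuous_fst.tendsto _).comp hlim
    have hW : Filter.Tendsto (fun k => t k • (x k).2) Filter.atTop (nhds W) :=
      (continuous_snd.tendsto _).comp hlim
    have hle : ∀ V ∈ K A, ∀ k, symInner V (x k).2 ≤
        -((1 / 2 : ℝ) * trace ((x k).1ᵀ * (V.1 * (x k).1))) := by
      intro V hV k
      have := mem_Kpolar_iff.1 (hx k).2 V hV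
      rw [symInner_add_right, symInner_halfGram] at this
      linarith
    have hYz : Y = 0 := by
      have h1 : Filter.Tendsto (fun k => trace ((t k • (x k).1)ᵀ * (t k • (x k).1)))
          Filter.atTop (nhds (trace (Yᵀ * Y))) := by
        have hc : Continuous fun Z : Matrix (Fin n) (Fin m) ℝ => trace (Zᵀ * Z) := by fun_prop
        exact (hc.tendsto Y).comp hY
      have h2 : Filter.Tendsto (fun k => -2 * (t k * symInner (symOne n) (t k • (x k).2)))
          Filter.atTop (nhds (-2 * (0 * symInner (symOne n) W))) :=
        (ht0.mul (((continuous_symInner_right _).tendsto W).comp hW)).const_mul _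
      -- Testing against V = I gives ‖Yₖ‖² ≤ -2 tr Wₖ; multiplied by tₖ², the right side is tₖ times
      -- a convergent sequence.
      have h3 : trace (Yᵀ * Y) ≤ 0 := by
        refine (le_of_tendsto_of_tendsto' h1 h2 fun k => ?_).trans (by simp)
        have h4 := hle _ symOne_mem_K k
        have h5 : (symOne n : Matrix (Fin n) (Fin n) ℝ) = 1 := rfl
        rw [h5, Matrix.one_mul] at h4
        rw [symInner_smul_right]
        simp only [transpose_smul, Matrix.mul_smul, Matrix.smul_mul, trace_smul, smul_eq_mul]
        have h6 := mul_le_mul_of_nonneg_left h4 (mul_nonneg (ht k).le (ht k).le)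
        linarith
      have h7 : 0 ≤ trace (Yᵀ * Y) := by
        simpa using (posSemidef_conjTranspose_mul_self Y).trace_nonneg
      rw [← trace_conjTranspose_mul_self_eq_zero_iff, conjTranspose_eq_transpose_of_trivial]
      exact le_antisymm h3 h7
    refine ⟨hYz, mem_Kpolar_iff.2 fun V hV => ?_⟩
    have h1 := ((continuous_symInner_right V).tendsto W).comp hW
    -- The form of V may be negative off ker A, so it is bounded below by its affine minorant at Y₀;
    -- after scaling by tₖ that minorant tends to 0 because Y = 0.
    have hc : Continuous fun Z : Matrix (Fin n) (Fin m) ℝ => trace (Y₀ᵀ * (V.1 * Z)) := by fun_prop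
    have h2 : Filter.Tendsto (fun k => t k * ((1 / 2 : ℝ) * trace (Y₀ᵀ * (V.1 * Y₀))) -
        trace (Y₀ᵀ * (V.1 * (t k • (x k).1)))) Filter.atTop
        (nhds (0 * ((1 / 2 : ℝ) * trace (Y₀ᵀ * (V.1 * Y₀))) - trace (Y₀ᵀ * (V.1 * Y)))) :=
      (ht0.mul_const _).sub ((hc.tendsto Y).comp hY)
    refine (le_of_tendsto_of_tendsto' h1 h2 fun k => ?_).trans (by simp [hYz])
    have h3 := hle V hV k
    have h4 := trace_quadratic_ge hV ((hx k).1.trans hY₀.symm)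
    have h5 : symInner V (x k).2 ≤
        (1 / 2 : ℝ) * trace (Y₀ᵀ * (V.1 * Y₀)) - trace (Y₀ᵀ * (V.1 * (x k).1)) := by linarith
    have h6 := mul_le_mul_of_nonneg_left h5 (ht k).le
    simp only [Function.comp_apply, symInner_smul_right, Matrix.mul_smul, trace_smul, smul_eq_mul]
    linarith
  · rintro ⟨hY, hW⟩
    obtain rfl : Y = 0 := hY
    have ht := tendsto_one_div_add_atTop_nhds_zero_nat (𝕜 := ℝ)
    refine ⟨fun k => 1 / ((k : ℝ) + 1), fun k => (Y₀, -halfGram Y₀ + ((k : ℝ) + 1) • W),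
      fun k => by positivity, fun a b hab => ?_, ht,
      fun k => mem_Omega_of_mem_Kpolar hY₀ (smul_mem_Kpolar hW (by positivity)), ?_⟩
    · have : (a : ℝ) ≤ b := by exact_mod_cast hab
      dsimp only
      gcongr
    · have h1 : Filter.Tendsto (fun k : ℕ => (1 / ((k : ℝ) + 1)) • ((Y₀, -halfGram Y₀) : E n m) +
          (0, W)) Filter.atTop (nhds ((0 : ℝ) • ((Y₀, -halfGram Y₀) : E n m) + (0, W))) :=
        (ht.smul_const _).add_const _
      rw [zero_smul, zero_add] at h1
      refine h1.congr fun k => ?_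
      rw [Prod.smul_mk, Prod.smul_mk, Prod.mk_add_mk, add_zero, smul_add, smul_smul,
        one_div_mul_cancel (by positivity), one_smul]

end GMF

theorem proposition4p6 {p n m : ℕ} (A : Matrix (Fin p) (Fin n) ℝ)
    (B : Matrix (Fin p) (Fin m) ℝ) (hAB : GMF.rge B ≤ GMF.rge A) :
    GMF.polar GMF.pairInner (GMF.Omega A B) =
      {P : GMF.E n m | GMF.rge (GMF.stack P.1 B) ≤ GMF.rge (GMF.M A P.2) ∧ P.2 ∈ GMF.K A ∧
        (1 / 2 : ℝ) * Matrix.trace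
          ((GMF.stack P.1 B)ᵀ * GMF.pinv (GMF.M A P.2) * GMF.stack P.1 B) ≤ 1} ∧
    GMF.horizonCone (GMF.Omega A B) =
      ({0} : Set (Matrix (Fin n) (Fin m) ℝ)) ×ˢ GMF.Kpolar A ∧
    GMF.horizonCone (GMF.polar GMF.pairInner (GMF.Omega A B)) =
      {P : GMF.E n m | GMF.rge (GMF.stack P.1 B) ≤ GMF.rge (GMF.M A P.2) ∧ P.2 ∈ GMF.K A ∧
        (1 / 2 : ℝ) * Matrix.trace
          ((GMF.stack P.1 B)ᵀ * GMF.pinv (GMF.M A P.2) * GMF.stack P.1 B) ≤ 0} := by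
  refine ⟨?_, GMF.horizonCone_Omega hAB, ?_⟩
  · ext P
    exact GMF.forall_pairInner_le_iff hAB P 1
  · rw [GMF.horizonCone_polar_pairInner]
    ext P
    exact GMF.forall_pairInner_le_iff hAB P 0
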